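/- Let $m\ge 0$, $q\ge 1$ be integers with $m+q\ge 2$, and let $C_{m,q}$ be the cyclic monoid of index $m$ and period $q$: its underlying set is $\{0,1,\dots,m+q-1\}$ and its addition is $x\oplus y=\wp(x+y)$, where $\wp(x)=x$ if $x<m+q$ and $\wp(x)=x-kq$ if $m+kq\le x<m+(k+1)q$. For $r\in\mathbb N$ write $r\cdot m=m\oplus\cdots\oplus m$ ($r$ times; here $m$ stands for $\wp(m)$). For a monoid $M$ (written additively), let $\mathbb HM$ be the category whose objects are the elements of $M$ and whose arrows are the triples $(x,y,z)\in M^3$, with $(x,y,z):y\to x+y+z$, composition $(u,x+y+z,v)(x,y,z)=(u+x,y,z+v)$ and identities $(0,x,0)$. Left (right) $\mathbb HM$-modules are functors $\mathbb HM\to\mathbf{Ab}$ (resp. $\mathbb HM^{op}\to\mathbf{Ab}$). For a right $\mathbb HM$-module $\mathcal B$ write $\mathcal B(x,y,z)=x^*z_*:\mathcal B(x+y+z)\to\mathcal B(y)$. For a left module $\mathcal A$, let $\mathcal B\otimes_{\mathbb HM}\mathcal A$ be the coend of $(x,y)\mapsto\mathcal B(x)\otimes\mathcal A(y)$, and define the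 Leech homology groups of $M$ by $$\mathrm H_n(M,\mathcal B)=\mathrm{Tor}_n^{\mathbb HM}(\mathcal B,\mathbb Z)=L_n(\mathcal B\otimes_{\mathbb HM}-)(\mathbb Z),\qquad n\ge 0,$$ where $\mathbb Z$ is the constant left module. Let $\mathcal B$ be any right $\mathbb HC_{m,q}$-module. For $x\in C_{m,q}$ let $S:\mathcal B(x\oplus 1)\to\mathcal B(x)$ be $S(b)=1_*b-1^*b$, and for $x\in C_{m,q}$ with $x\ge 1$ let $T:\mathcal B(m\oplus(x-1))\to\mathcal B(x)$ be $$T(b)=\sum_{t=0}^{m+q-1}t^*(m+q-t-1)_*b-\sum_{t=0}^{m-1}t^*(m-t-1)_*b .$$ Then $$\mathrm H_0(C_{m,q},\mathcal B)\cong\frac{\mathcal B(0)}{\operatorname{im}\big(S:\mathcal B(1)\to\mathcal B(0)\big)},$$ and, for every $r\ge 0$, one has $ST=0$ and $TS=0$ for the maps below and $$\mathrm H_{2r+1}(C_{m,q},\mathcal B)\cong\frac{\ker\big(S:\mathcal B(r\cdot m\oplus 1)\to\mathcal B(r\cdot m)\big)}{\operatorname{im}\big(T:\mathcal B((r+1)\cdot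 m)\to\mathcal B(r\cdot m\oplus 1)\big)},$$ $$\mathrm H_{2r+2}(C_{m,q},\mathcal B)\cong\frac{\ker\big(T:\mathcal B((r+1)\cdot m)\to\mathcal B(r\cdot m\oplus 1)\big)}{\operatorname{im}\big(S:\mathcal B((r+1)\cdot m\oplus 1)\to\mathcal B((r+1)\cdot m)\big)}.$$ (Here $(r+1)\cdot m=m\oplus((r\cdot m\oplus 1)-1)$.) -/

import Mathlib

open CategoryTheory CategoryTheory.Limits Opposite

universe w u

/-! ### The category of factorizations of a monoid -/

/-- The objects of the category `ℍM` of factorizations of an additive monoid `M`: the elements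
of `M`. -/
structure Factorizations (M : Type w) where
  /-- The underlying element of the monoid. -/
  val : M

namespace Factorizations

variable {M : Type w} [AddMonoid M]

/-- The arrows of `ℍM` from `y` to `z` are the triples `(u, y, v)` with `u + y + v = z`. -/
@[ext]
structure Hom (y z : Factorizations M) where
  /-- The element added on the left. -/
  left : M
  /-- The element added on the right. -/
  right : M
  eq : left + y.val + right = z.val

/-- The category `ℍM`; the composite of `(x, y, z) : y ⟶ x + y + z` followed by
`(u, x + y + z, v)` is `(u + x, y, z + v)`. -/
instance : Category.{w} (Factorizations M) where
  Hom := Hom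
  id x := ⟨0, 0, by simp⟩
  comp f g := ⟨g.left + f.left, f.right + g.right, by
    rw [← g.eq, ← f.eq]; simp only [add_assoc]⟩
  id_comp f := by ext <;> simp
  comp_id f := by ext <;> simp
  assoc f g h := by ext <;> simp [add_assoc]

/-- The arrow `(a, y, b) : y ⟶ z` of `ℍM`, where `a + y + b = z`. -/
def arrow {y z : M} (a b : M) (h : a + y + b = z) :
    (Factorizations.mk y) ⟶ (Factorizations.mk z) :=
  Hom.mk (y := ⟨y⟩) (z := ⟨z⟩) a b h

end Factorizations

/-- Left `ℍM`-modules: functors from `ℍM` to abelian groups. -/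
abbrev LeftHModule (M : Type w) [AddMonoid M] :=
  Factorizations M ⥤ AddCommGrpCat.{max u w}

/-- Right `ℍM`-modules: functors from `ℍMᵒᵖ` to abelian groups. -/
abbrev RightHModule (M : Type w) [AddMonoid M] :=
  (Factorizations M)ᵒᵖ ⥤ AddCommGrpCat.{max u w}

/-- The value `B(x)` of a right `ℍM`-module at an element `x` of `M`. -/
abbrev RightHModule.at {M : Type w} [AddMonoid M] (B : RightHModule.{w, u} M) (x : M) :
    Type (max u w) :=
  B.obj (op (Factorizations.mk x))

/-- For a right `ℍM`-module `B`, the homomorphism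
`a^* b_* = B(a, x, b) : B(y) → B(x)`, where `a + x + b = y`. -/
def RightHModule.act {M : Type w} [AddMonoid M] (B : RightHModule.{w, u} M) {x y : M}
    (a b : M) (h : a + x + b = y) : B.at y →+ B.at x :=
  (B.map (Factorizations.arrow a b h).op).hom

/-- The trivial left `ℍM`-module `ℤ`: the constant functor with value the group of integers. -/
def trivialHModule (M : Type w) [AddMonoid M] : LeftHModule.{w, u} M :=
  (Functor.const _).obj (AddCommGrpCat.of (ULift.{max u w} ℤ))

/-! ### Tensor product of `ℍM`-modules -/

section Tensor

open TensorProduct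

/-- The tensor product over `ℤ` of two homomorphisms of abelian groups. -/
def tensorHomAb {A A' B B' : AddCommGrpCat.{u}} (f : A ⟶ A') (g : B ⟶ B') :
    AddCommGrpCat.of (A ⊗[ℤ] B) ⟶ AddCommGrpCat.of (A' ⊗[ℤ] B') :=
  AddCommGrpCat.ofHom
    (TensorProduct.map f.hom.toIntLinearMap g.hom.toIntLinearMap).toAddMonoidHom

theorem tensorHomAb_id (A B : AddCommGrpCat.{u}) :
    tensorHomAb (𝟙 A) (𝟙 B) = 𝟙 (AddCommGrpCat.of (A ⊗[ℤ] B)) := by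
  ext x
  induction x using TensorProduct.induction_on with
  | zero => simp
  | tmul a b => rfl
  | add a b ha hb => rw [map_add, map_add, ha, hb]

theorem tensorHomAb_comp {A A' A'' B B' B'' : AddCommGrpCat.{u}} (f : A ⟶ A') (f' : A' ⟶ A'')
    (g : B ⟶ B') (g' : B' ⟶ B'') :
    tensorHomAb (f ≫ f') (g ≫ g') = tensorHomAb f g ≫ tensorHomAb f' g' := by
  ext x
  induction x using TensorProduct.induction_on with
  | zero => simp
  | tmul a b => rfl
  | add a b ha hb => rw [map_add, map_add, ha, hb]

theorem tensorHomAb_add_right {A A' B B' : AddCommGrpCat.{u}} (f : A ⟶ A') (g g' : B ⟶ B') :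
    tensorHomAb f (g + g') = tensorHomAb f g + tensorHomAb f g' := by
  ext x
  induction x using TensorProduct.induction_on with
  | zero => simp
  | tmul a b => exact TensorProduct.tmul_add _ _ _
  | add a b ha hb => rw [map_add, map_add, ha, hb]

variable {M : Type w} [AddMonoid M]

/-- The bifunctor `(x, y) ↦ B(x) ⊗ A(y)`, contravariant in `x` and covariant in `y`. -/
def tensorBifunctor (B : RightHModule.{w, u} M) (A : LeftHModule.{w, u} M) :
    (Factorizations M)ᵒᵖ ⥤ Factorizations M ⥤ AddCommGrpCat.{max u w} where
  obj x :=
    { obj := fun y => AddCommGrpCat.of (B.obj x ⊗[ℤ] A.obj y)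
      map := fun g => tensorHomAb (𝟙 (B.obj x)) (A.map g)
      map_id := fun y => by rw [A.map_id, tensorHomAb_id]
      map_comp := fun g g' => by
        rw [A.map_comp, ← tensorHomAb_comp, Category.id_comp] }
  map f :=
    { app := fun y => tensorHomAb (B.map f) (𝟙 (A.obj y))
      naturality := fun y y' g => by
        dsimp only
        rw [← tensorHomAb_comp, ← tensorHomAb_comp]
        simp only [Category.id_comp, Category.comp_id] }
  map_id x := by
    ext1; funext y
    exact (congrArg (fun k => tensorHomAb k (𝟙 (A.obj y))) (B.map_id x)).trans
      (tensorHomAb_id _ _)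
  map_comp f f' := by
    ext1; funext y
    change tensorHomAb (B.map (f ≫ f')) (𝟙 (A.obj y)) =
      tensorHomAb (B.map f) (𝟙 (A.obj y)) ≫ tensorHomAb (B.map f') (𝟙 (A.obj y))
    rw [← tensorHomAb_comp, B.map_comp, Category.id_comp]

/-- The transformation of bifunctors `B(x) ⊗ A(y) → B(x) ⊗ A'(y)` induced by a morphism of left
`ℍM`-modules `A ⟶ A'`. -/
def tensorBifunctorMap (B : RightHModule.{w, u} M) {A A' : LeftHModule.{w, u} M} (f : A ⟶ A') :
    tensorBifunctor B A ⟶ tensorBifunctor B A' where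
  app x :=
    { app := fun y => tensorHomAb (𝟙 (B.obj x)) (f.app y)
      naturality := fun y y' g => by
        change tensorHomAb (𝟙 (B.obj x)) (A.map g) ≫ tensorHomAb (𝟙 (B.obj x)) (f.app y') =
          tensorHomAb (𝟙 (B.obj x)) (f.app y) ≫ tensorHomAb (𝟙 (B.obj x)) (A'.map g)
        rw [← tensorHomAb_comp, ← tensorHomAb_comp, f.naturality] }
  naturality x x' g := by
    ext1; funext y
    change tensorHomAb (B.map g) (𝟙 (A.obj y)) ≫ tensorHomAb (𝟙 (B.obj x')) (f.app y) =
      tensorHomAb (𝟙 (B.obj x)) (f.app y) ≫ tensorHomAb (B.map g) (𝟙 (A'.obj y))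
    rw [← tensorHomAb_comp, ← tensorHomAb_comp]
    simp only [Category.id_comp, Category.comp_id]

/-- The functor `B ⊗_{ℍM} -` from left `ℍM`-modules to abelian groups, whose value at `A` is the
coend of the bifunctor `(x, y) ↦ B(x) ⊗ A(y)`. -/
noncomputable def tensorFunctor (B : RightHModule.{w, u} M) :
    LeftHModule.{w, u} M ⥤ AddCommGrpCat.{max u w} where
  obj A := coend (tensorBifunctor B A)
  map f := coend.map (tensorBifunctorMap B f)
  map_id A := by
    apply coend.hom_ext
    intro x
    rw [coend.ι_map, Category.comp_id]
    exact (congrArg (· ≫ _) (tensorHomAb_id _ _)).trans (Category.id_comp _)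
  map_comp f g := by
    rw [coend.map_comp]
    congr 1
    ext x y : 4
    change tensorHomAb _ _ = tensorHomAb _ _ ≫ tensorHomAb _ _
    rw [← tensorHomAb_comp, Category.id_comp]
    rfl

instance (B : RightHModule.{w, u} M) : (tensorFunctor B).Additive where
  map_add {A A' f g} := by
    change coend.map (tensorBifunctorMap B (f + g)) =
      coend.map (tensorBifunctorMap B f) + coend.map (tensorBifunctorMap B g)
    apply coend.hom_ext
    intro x
    rw [Preadditive.comp_add, coend.ι_map, coend.ι_map, coend.ι_map, ← Preadditive.add_comp]
    congr 1
    exact tensorHomAb_add_right _ _ _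

end Tensor

/-! ### Enough projectives, and Leech homology -/

instance enoughProjectivesAddCommGrpCat : EnoughProjectives AddCommGrpCat.{u} :=
  (forget₂ (ModuleCat.{u} ℤ) AddCommGrpCat.{u}).asEquivalence.enoughProjectives_iff.mp
    inferInstance

/-- The category of left `ℍM`-modules has enough projectives. -/
instance enoughProjectivesLeftHModule (M : Type w) [AddMonoid M] :
    EnoughProjectives (LeftHModule.{w, u} M) where
  presentation F := by
    let P : Factorizations M → LeftHModule.{w, u} M := fun c =>
      (evaluationLeftAdjoint AddCommGrpCat.{max u w} c).obj (Projective.over (F.obj c))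
    have hP : ∀ c, Projective (P c) := fun c =>
      (evaluationAdjunctionRight AddCommGrpCat.{max u w} c).map_projective _ inferInstance
    let p : ∀ c, P c ⟶ F := fun c =>
      ((evaluationAdjunctionRight AddCommGrpCat.{max u w} c).homEquiv _ _).symm
        (Projective.π (F.obj c))
    have hc : HasCoproduct P := inferInstance
    have hs : Projective (∐ P) := ⟨fun f e _ =>
      ⟨Sigma.desc fun c => Projective.factorThru (Sigma.ι P c ≫ f) e, by
        apply Sigma.hom_ext
        intro c
        rw [Sigma.ι_desc_assoc, Projective.factorThru_comp]⟩⟩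
    refine ⟨{ p := ∐ P, f := Sigma.desc p, projective := hs, epi := ?_ }⟩
    rw [NatTrans.epi_iff_epi_app]
    intro c
    have h : ((evaluationAdjunctionRight AddCommGrpCat.{max u w} c).unit.app _ ≫
        (Sigma.ι P c).app c) ≫ (Sigma.desc p).app c = Projective.π (F.obj c) := by
      rw [Category.assoc, ← NatTrans.comp_app, Sigma.ι_desc]
      exact ((evaluationAdjunctionRight AddCommGrpCat.{max u w} c).homEquiv _ _).apply_symm_apply _
    exact epi_of_epi_fac h

/-- The Leech homology group `H_n(M, B) = Tor_n^{ℍM}(B, ℤ) = L_n(B ⊗_{ℍM} -)(ℤ)` of the monoid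
`M` with coefficients in the right `ℍM`-module `B`. -/
noncomputable def leechHomology {M : Type w} [AddMonoid M] (B : RightHModule.{w, u} M) (n : ℕ) :
    AddCommGrpCat.{max u w} :=
  ((tensorFunctor B).leftDerived n).obj (trivialHModule.{w, u} M)

/-! ### Finite cyclic monoids -/

/-- The underlying set `{0, 1, …, m + q - 1}` of the cyclic monoid `C_{m,q}` of index `m` and
period `q`. -/
@[ext]
structure CyclicMonoid (m q : ℕ) where
  /-- The representative of an element in `{0, 1, …, m + q - 1}`. -/
  val : ℕ
  lt : val < m + q

namespace CyclicMonoid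

variable {m q : ℕ}

/-- The representative in `{0, 1, …, m + q - 1}` of a natural number `x` for the congruence of
index `m` and period `q`: `x` itself if `x < m + q`, and otherwise `x - k q`, where
`m + k q ≤ x < m + (k + 1) q`. -/
def rep (m q x : ℕ) : ℕ := if x < m + q then x else m + (x - m) % q

theorem rep_of_lt {x : ℕ} (h : x < m + q) : rep m q x = x := if_pos h

theorem rep_of_le {x : ℕ} (h : m ≤ x) : rep m q x = m + (x - m) % q := by
  unfold rep
  split_ifs with h'
  · rw [Nat.mod_eq_of_lt (by omega)]; omega
  · rfl

theorem rep_lt [NeZero q] (x : ℕ) : rep m q x < m + q := by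
  unfold rep
  split_ifs with h
  · exact h
  · exact Nat.add_lt_add_left (Nat.mod_lt _ (Nat.pos_of_neZero q)) m

theorem rep_rep_add (x y : ℕ) : rep m q (rep m q x + y) = rep m q (x + y) := by
  by_cases h : x < m + q
  · rw [rep_of_lt h]
  · have hx : m ≤ x := by omega
    rw [rep_of_le hx, rep_of_le (by omega), rep_of_le (by omega),
      show m + (x - m) % q + y - m = (x - m) % q + y by omega,
      show x + y - m = (x - m) + y by omega, Nat.mod_add_mod]

theorem rep_add_rep (x y : ℕ) : rep m q (x + rep m q y) = rep m q (x + y) := by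
  rw [add_comm, rep_rep_add, add_comm]

/-- The projection `℘ : ℕ → C_{m,q}`. -/
def proj (m q : ℕ) [NeZero q] (x : ℕ) : CyclicMonoid m q := ⟨rep m q x, rep_lt x⟩

instance [NeZero q] : Zero (CyclicMonoid m q) := ⟨proj m q 0⟩

/-- The addition of `C_{m,q}` is `x ⊕ y = ℘(x + y)`. -/
instance [NeZero q] : Add (CyclicMonoid m q) := ⟨fun x y => proj m q (x.val + y.val)⟩

instance [NeZero q] : AddCommMonoid (CyclicMonoid m q) where
  add_assoc x y z := by
    ext
    change rep m q (rep m q (x.val + y.val) + z.val) = rep m q (x.val + rep m q (y.val + z.val))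
    rw [rep_rep_add, rep_add_rep, add_assoc]
  zero_add x := by
    ext
    change rep m q (rep m q 0 + x.val) = x.val
    rw [rep_rep_add, zero_add, rep_of_lt x.lt]
  add_zero x := by
    ext
    change rep m q (x.val + rep m q 0) = x.val
    rw [rep_add_rep, add_zero, rep_of_lt x.lt]
  add_comm x y := by
    ext
    change rep m q (x.val + y.val) = rep m q (y.val + x.val)
    rw [add_comm]
  nsmul := nsmulRec

theorem proj_add [NeZero q] (x y : ℕ) : proj m q (x + y) = proj m q x + proj m q y := by
  ext
  change rep m q (x + y) = rep m q (rep m q x + rep m q y)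
  rw [rep_rep_add, rep_add_rep]

theorem proj_val [NeZero q] (x : CyclicMonoid m q) : proj m q x.val = x := by
  ext
  exact rep_of_lt x.lt

theorem proj_add_period [NeZero q] {x : ℕ} (h : m ≤ x) : proj m q (x + q) = proj m q x := by
  ext
  change rep m q (x + q) = rep m q x
  rw [rep_of_le h, rep_of_le (by omega), show x + q - m = (x - m) + q by omega, Nat.add_mod_right]

theorem nsmul_proj [NeZero q] (r x : ℕ) : r • proj m q x = proj m q (r * x) := by
  induction r with
  | zero => rw [zero_nsmul, zero_mul]; rfl
  | succ k ih => rw [succ_nsmul, ih, ← proj_add, Nat.succ_mul]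

/-- The element `x - 1` of `C_{m,q}`, for `x ≥ 1`. -/
def pred (x : CyclicMonoid m q) : CyclicMonoid m q :=
  ⟨x.val - 1, lt_of_le_of_lt (Nat.sub_le _ _) x.lt⟩

theorem proj_pred_add_one [NeZero q] {x : CyclicMonoid m q} (hx : 1 ≤ x.val) :
    proj m q ((pred x).val + 1) = x := by
  ext
  change rep m q (x.val - 1 + 1) = x.val
  rw [Nat.sub_add_cancel hx, rep_of_lt x.lt]

/-- If `t + s + 1 = m + q`, then `t ⊕ x ⊕ s = m ⊕ (x - 1)`. -/
theorem add_add_of_period [NeZero q] {x y : CyclicMonoid m q} (hx : 1 ≤ x.val)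
    (hy : y = proj m q m + pred x) {t s : ℕ} (h : t + s + 1 = m + q ∨ t + s + 1 = m) :
    proj m q t + x + proj m q s = y := by
  rw [hy, ← proj_val (pred x), ← proj_add]
  conv_lhs => rw [← proj_pred_add_one hx, ← proj_add, ← proj_add]
  rcases h with h | h
  · rw [show t + ((pred x).val + 1) + s = (m + (pred x).val) + q by omega,
      proj_add_period (by omega)]
  · rw [show t + ((pred x).val + 1) + s = m + (pred x).val by omega]

/-- `r · m ⊕ 1 ≥ 1` unless `C_{m,q}` is the zero monoid. -/
theorem one_le_val_nsmul_add_one [NeZero q] (h : 2 ≤ m + q) (r : ℕ) :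
    1 ≤ (r • proj m q m + proj m q 1).val := by
  rw [nsmul_proj, ← proj_add]
  change 1 ≤ rep m q (r * m + 1)
  by_cases h' : r * m + 1 < m + q
  · rw [rep_of_lt h']; omega
  · rcases Nat.eq_zero_or_pos m with h0 | h0
    · subst h0; simp at h'; omega
    · rw [rep_of_le (by omega)]; omega

/-- `(r + 1) · m = m ⊕ ((r · m ⊕ 1) - 1)`. -/
theorem succ_nsmul_eq [NeZero q] (h : 2 ≤ m + q) (r : ℕ) :
    (r + 1) • proj m q m = proj m q m + pred (r • proj m q m + proj m q 1) := by
  have h1 := one_le_val_nsmul_add_one h r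
  rw [← proj_val (pred _), ← proj_add]
  rw [nsmul_proj, ← proj_add] at h1
  rw [nsmul_proj, nsmul_proj, ← proj_add]
  ext
  change rep m q ((r + 1) * m) = rep m q (m + (rep m q (r * m + 1) - 1))
  change 1 ≤ rep m q (r * m + 1) at h1
  by_cases h' : r * m + 1 < m + q
  · rw [rep_of_lt h', Nat.add_sub_cancel, Nat.succ_mul, add_comm]
  · have hle : m ≤ r * m + 1 := by omega
    rw [rep_of_le hle] at h1 ⊢
    rw [rep_of_le (by rw [Nat.succ_mul]; omega), rep_of_le (by omega)]
    congr 1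
    have hk : (r + 1) * m - m = r * m := by rw [Nat.succ_mul]; omega
    rw [hk, Nat.add_sub_cancel_left]
    have hd := Nat.div_add_mod (r * m + 1 - m) q
    have he : r * m = (m + (r * m + 1 - m) % q - 1) + q * ((r * m + 1 - m) / q) := by omega
    conv_lhs => rw [he]
    rw [Nat.add_mul_mod_self_left]

end CyclicMonoid

/-! ### The maps `S` and `T` of a right module over a cyclic monoid -/

section Maps

open CyclicMonoid

variable {m q : ℕ} [NeZero q]

/-- The homomorphism `S : B(x ⊕ 1) → B(x)`, `S(b) = 1_* b - 1^* b`. -/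
def mapS (B : RightHModule.{0, u} (CyclicMonoid m q)) (x : CyclicMonoid m q) :
    B.at (x + proj m q 1) →+ B.at x :=
  B.act 0 (proj m q 1) (by rw [zero_add]) - B.act (proj m q 1) 0 (by rw [add_zero, add_comm])

/-- The trace map `T : B(y) → B(x)`, for `x ≥ 1` and `y = m ⊕ (x - 1)`,
`T(b) = ∑_{t=0}^{m+q-1} t^* (m+q-t-1)_* b - ∑_{t=0}^{m-1} t^* (m-t-1)_* b`. -/
def mapT (B : RightHModule.{0, u} (CyclicMonoid m q)) (x y : CyclicMonoid m q)
    (hx : 1 ≤ x.val) (hy : y = proj m q m + pred x) : B.at y →+ B.at x :=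
  ∑ t : Fin (m + q), B.act (proj m q t) (proj m q (m + q - t - 1))
      (add_add_of_period hx hy (Or.inl (by omega)))
    - ∑ t : Fin m, B.act (proj m q t) (proj m q (m - t - 1))
      (add_add_of_period hx hy (Or.inr (by omega)))

/-- The trace map `T : B((r + 1) · m) → B(r · m ⊕ 1)`. -/
def mapTAt (B : RightHModule.{0, u} (CyclicMonoid m q)) (h : 2 ≤ m + q) (r : ℕ) :
    B.at ((r + 1) • proj m q m) →+ B.at (r • proj m q m + proj m q 1) :=
  mapT B _ _ (one_le_val_nsmul_add_one h r) (succ_nsmul_eq h r)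

end Maps

/-!
The Leech homology of `C_{m,q}` is computed from a resolution of the constant module `ℤ` by
representable left `ℍM`-modules. Two facts carry the argument.

* Co-Yoneda. The module `ℤ[Hom(c, -)]` is projective, and `B ⊗ ℤ[Hom(c, -)] ≅ B(c)`; under this
  isomorphism a morphism of representable modules, given by a formal combination of arrows, becomes
  the action of that combination on `B` (`tensorFreeIso`, `tensorFreeIso_naturality`). Hence any
  resolution of `ℤ` by modules of this form turns into an explicit complex with terms `B(c n)` whose
  homology is the Leech homology (`FreeResolution.nonempty_leechHomology_succ`,
  `FreeResolution.nonempty_leechHomology_zero`).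

* The periodic resolution. An arrow `x ⟶ z` of `ℍ C_{m,q}` is a pair `(a, b)` with
  `a ⊕ x ⊕ b = z`, so the values at all `z` of the module represented by `x` add up to the monoid
  ring of `C × C`, that is, to `ℤ[X, Y] / (f(X), f(Y))` with `f = X ^ (m + q) - X ^ m`. The maps `S`
  and `T` are given by multiplication by `Y - X` and by `(f(Y) - f(X)) / (Y - X)`, and these
  alternate in the classical resolution of `ℤ[X] / f` over its enveloping ring. Counting degrees,
  the generators live at the objects `r · m` and `r · m ⊕ 1`. Exactness is proved by a contracting
  homotopy which preserves `z`: from even to odd degrees it sends `X ^ a Y ^ b` with `b < m + q` to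
  `∑_{i < b} X ^ (a + i) Y ^ (b - 1 - i)`, and from odd to even degrees it picks out the coefficient
  of `Y ^ (m + q - 1)` (`homotopyS_diffS_add`, `homotopyT_diffT_add`,
  `diffS_homotopyS_of_aug_eq_zero`).

That the composites of `S` and `T` vanish follows from the same identification, as the differential
of the resolution squares to zero.
-/

/-! ### Representable modules over the category of factorizations -/

section Free

open TensorProduct

variable {M : Type w} [AddMonoid M]

/-- The action of a left `ℍM`-module `G`, extended to formal `ℤ`-linear combinations of arrows
`c ⟶ z`. -/
def leftAct (G : LeftHModule.{w, u} M) (c z : Factorizations M) :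
    FreeAbelianGroup (ULift.{max u w} (c ⟶ z)) →+ G.obj c →+ G.obj z :=
  FreeAbelianGroup.lift fun f => (G.map f.down).hom

/-- The action of a right `ℍM`-module `B`, extended to formal `ℤ`-linear combinations of arrows
`c ⟶ z`. -/
def rightAct (B : RightHModule.{w, u} M) (c z : Factorizations M) :
    FreeAbelianGroup (ULift.{max u w} (c ⟶ z)) →+ B.obj (op z) →+ B.obj (op c) :=
  FreeAbelianGroup.lift fun f => (B.map f.down.op).hom

@[simp]
theorem leftAct_of (G : LeftHModule.{w, u} M) {c z : Factorizations M}
    (f : ULift.{max u w} (c ⟶ z)) (g : G.obj c) :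
    leftAct G c z (FreeAbelianGroup.of f) g = G.map f.down g :=
  DFunLike.congr_fun (FreeAbelianGroup.lift_apply_of _ f) g

@[simp]
theorem rightAct_of (B : RightHModule.{w, u} M) {c z : Factorizations M}
    (f : ULift.{max u w} (c ⟶ z)) (b : B.obj (op z)) :
    rightAct B c z (FreeAbelianGroup.of f) b = B.map f.down.op b :=
  DFunLike.congr_fun (FreeAbelianGroup.lift_apply_of _ f) b

/-- The left `ℍM`-module freely generated by one element at the object `c`: its value at `z` is
the free abelian group on the arrows `c ⟶ z`. -/
def freeHModule (c : Factorizations M) : LeftHModule.{w, u} M where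
  obj z := AddCommGrpCat.of (FreeAbelianGroup (ULift.{max u w} (c ⟶ z)))
  map g := AddCommGrpCat.ofHom (FreeAbelianGroup.map fun f => ULift.up (f.down ≫ g))
  map_id z := by
    ext f
    simp
  map_comp g g' := by
    ext f
    simp

theorem freeHModule_map_of {c y z : Factorizations M} (g : y ⟶ z) (f : ULift.{max u w} (c ⟶ y)) :
    (freeHModule.{w, u} c).map g (FreeAbelianGroup.of f) =
      FreeAbelianGroup.of (ULift.up (f.down ≫ g)) :=
  FreeAbelianGroup.map_of_apply f

/-- Two homomorphisms out of a value of a free module agree if they agree on arrows. -/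
theorem freeHModule_obj_hom_ext {c z : Factorizations M} {A : AddCommGrpCat.{max u w}}
    {φ ψ : (freeHModule.{w, u} c).obj z ⟶ A}
    (h : ∀ f : ULift.{max u w} (c ⟶ z),
      φ.hom (FreeAbelianGroup.of f) = ψ.hom (FreeAbelianGroup.of f)) : φ = ψ :=
  AddCommGrpCat.hom_ext (FreeAbelianGroup.lift_ext _ _ h)

/-- The morphism from the free module on one generator at `c` which sends the generator to `g`. -/
def freeHModuleDesc {G : LeftHModule.{w, u} M} {c : Factorizations M} (g : G.obj c) :
    freeHModule.{w, u} c ⟶ G where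
  app z := AddCommGrpCat.ofHom ((leftAct G c z).flip g)
  naturality y z k := by
    refine freeHModule_obj_hom_ext fun f => ?_
    change leftAct G c z ((freeHModule.{w, u} c).map k (FreeAbelianGroup.of f)) g =
      G.map k (leftAct G c y (FreeAbelianGroup.of f) g)
    rw [freeHModule_map_of, leftAct_of, leftAct_of, G.map_comp]
    rfl

theorem freeHModuleDesc_app {G : LeftHModule.{w, u} M} {c : Factorizations M} (g : G.obj c)
    (z : Factorizations M) (p : (freeHModule.{w, u} c).obj z) :
    (freeHModuleDesc g).app z p = leftAct G c z p g :=
  rfl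

/-- The generator of `freeHModule c`. -/
def freeHModuleGen (c : Factorizations M) : (freeHModule.{w, u} c).obj c :=
  FreeAbelianGroup.of (ULift.up (𝟙 c))

theorem freeHModuleDesc_gen {G : LeftHModule.{w, u} M} {c : Factorizations M} (g : G.obj c) :
    (freeHModuleDesc g).app c (freeHModuleGen c) = g := by
  rw [freeHModuleDesc_app]
  refine (leftAct_of G _ g).trans ?_
  rw [G.map_id]
  rfl

theorem freeHModule_hom_ext {G : LeftHModule.{w, u} M} {c : Factorizations M}
    {φ ψ : freeHModule.{w, u} c ⟶ G}
    (h : φ.app c (freeHModuleGen c) = ψ.app c (freeHModuleGen c)) : φ = ψ := by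
  ext z : 2
  refine freeHModule_obj_hom_ext fun f => ?_
  have key : ∀ χ : freeHModule.{w, u} c ⟶ G,
      χ.app z (FreeAbelianGroup.of f) = G.map f.down (χ.app c (freeHModuleGen c)) := by
    intro χ
    have := ConcreteCategory.congr_hom (χ.naturality f.down) (freeHModuleGen c)
    refine Eq.trans ?_ this
    change _ = χ.app z ((freeHModule.{w, u} c).map f.down (FreeAbelianGroup.of _))
    rw [freeHModule_map_of]
    congr 2
    ext1
    exact (Category.id_comp _).symm
  exact (key φ).trans ((congrArg _ h).trans (key ψ).symm)

instance projective_freeHModule (c : Factorizations M) :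
    Projective (freeHModule.{w, u} c) where
  factors {E X} f e he := by
    have hs : Function.Surjective (e.app c) :=
      (AddCommGrpCat.epi_iff_surjective _).1 ((NatTrans.epi_iff_epi_app e).1 he c)
    obtain ⟨g, hg⟩ := hs (f.app c (freeHModuleGen c))
    refine ⟨freeHModuleDesc g, freeHModule_hom_ext ?_⟩
    refine Eq.trans ?_ hg
    exact congrArg (e.app c) (freeHModuleDesc_gen g)

/-- The class of `b ⊗ p` in the coend `B ⊗ A`, for `b` in `B(x)` and `p` in `A(x)`. -/
noncomputable def tensorι (B : RightHModule.{w, u} M) (A : LeftHModule.{w, u} M)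
    (x : Factorizations M) : B.obj (op x) ⊗[ℤ] A.obj x →+ (tensorFunctor B).obj A :=
  (coend.ι (tensorBifunctor B A) x).hom

theorem tensorι_condition (B : RightHModule.{w, u} M) (A : LeftHModule.{w, u} M)
    {x y : Factorizations M} (f : x ⟶ y) (b : B.obj (op y)) (p : A.obj x) :
    tensorι B A x (B.map f.op b ⊗ₜ[ℤ] p) = tensorι B A y (b ⊗ₜ[ℤ] A.map f p) :=
  ConcreteCategory.congr_hom (coend.condition (tensorBifunctor B A) f) (b ⊗ₜ[ℤ] p)

theorem tensorFunctor_map_tensorι (B : RightHModule.{w, u} M) {A A' : LeftHModule.{w, u} M}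
    (φ : A ⟶ A') (x : Factorizations M) (b : B.obj (op x)) (p : A.obj x) :
    (tensorFunctor B).map φ (tensorι B A x (b ⊗ₜ[ℤ] p)) = tensorι B A' x (b ⊗ₜ[ℤ] φ.app x p) :=
  ConcreteCategory.congr_hom (coend.ι_map (tensorBifunctorMap B φ) x) (b ⊗ₜ[ℤ] p)

theorem addMonoidHom_tensor_ext {X Y Z : Type*} [AddCommGroup X] [AddCommGroup Y]
    [AddCommGroup Z] {φ ψ : X ⊗[ℤ] Y →+ Z} (h : ∀ x y, φ (x ⊗ₜ y) = ψ (x ⊗ₜ y)) : φ = ψ := by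
  ext t
  induction t using TensorProduct.induction_on with
  | zero => rw [map_zero, map_zero]
  | tmul b p => exact h b p
  | add s t hs ht => rw [map_add, map_add, hs, ht]

theorem tensor_hom_ext {B : RightHModule.{w, u} M} {A : LeftHModule.{w, u} M}
    {X : AddCommGrpCat.{max u w}} {φ ψ : (tensorFunctor B).obj A ⟶ X}
    (h : ∀ x (b : B.obj (op x)) (p : A.obj x),
      φ (tensorι B A x (b ⊗ₜ[ℤ] p)) = ψ (tensorι B A x (b ⊗ₜ[ℤ] p))) : φ = ψ :=
  coend.hom_ext fun x => AddCommGrpCat.hom_ext (addMonoidHom_tensor_ext (h x))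

/-- The homomorphism out of `B ⊗ A` given by a family of homomorphisms `B(x) ⊗ A(x) → X` which
is dinatural in `x`. -/
noncomputable def tensorDesc {B : RightHModule.{w, u} M} {A : LeftHModule.{w, u} M}
    {X : AddCommGrpCat.{max u w}} (φ : ∀ x, B.obj (op x) ⊗[ℤ] A.obj x →+ X)
    (hφ : ∀ x y (f : x ⟶ y) (b : B.obj (op y)) (p : A.obj x),
      φ x (B.map f.op b ⊗ₜ[ℤ] p) = φ y (b ⊗ₜ[ℤ] A.map f p)) :
    (tensorFunctor B).obj A ⟶ X :=
  coend.desc (F := tensorBifunctor B A) (fun x => AddCommGrpCat.ofHom (φ x)) fun x y f =>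
    AddCommGrpCat.hom_ext (addMonoidHom_tensor_ext (hφ x y f))

theorem tensorDesc_tensorι {B : RightHModule.{w, u} M} {A : LeftHModule.{w, u} M}
    {X : AddCommGrpCat.{max u w}} (φ : ∀ x, B.obj (op x) ⊗[ℤ] A.obj x →+ X)
    (hφ : ∀ x y (f : x ⟶ y) (b : B.obj (op y)) (p : A.obj x),
      φ x (B.map f.op b ⊗ₜ[ℤ] p) = φ y (b ⊗ₜ[ℤ] A.map f p))
    (x : Factorizations M) (t : B.obj (op x) ⊗[ℤ] A.obj x) :
    tensorDesc φ hφ (tensorι B A x t) = φ x t :=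
  ConcreteCategory.congr_hom (coend.ι_desc (F := tensorBifunctor B A) _ _ x) t

theorem rightAct_map (B : RightHModule.{w, u} M) (c : Factorizations M) {x y : Factorizations M}
    (k : x ⟶ y) (b : B.obj (op y)) (p : (freeHModule.{w, u} c).obj x) :
    rightAct B c x p (B.map k.op b) = rightAct B c y ((freeHModule.{w, u} c).map k p) b := by
  have h : (rightAct B c x).flip (B.map k.op b) =
      ((rightAct B c y).flip b).comp ((freeHModule.{w, u} c).map k).hom := by
    refine FreeAbelianGroup.lift_ext _ _ fun f => ?_
    change rightAct B c x (FreeAbelianGroup.of f) (B.map k.op b) =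
      rightAct B c y ((freeHModule.{w, u} c).map k (FreeAbelianGroup.of f)) b
    rw [freeHModule_map_of, rightAct_of, rightAct_of, op_comp, B.map_comp]
    rfl
  exact DFunLike.congr_fun h p

/-- Every class in `B ⊗ ℤ[Hom(c, -)]` is represented by a tensor with the generator. -/
theorem tensorι_freeHModule (B : RightHModule.{w, u} M) {c x : Factorizations M}
    (b : B.obj (op x)) (p : (freeHModule.{w, u} c).obj x) :
    tensorι B (freeHModule.{w, u} c) x (b ⊗ₜ[ℤ] p) =
      tensorι B (freeHModule.{w, u} c) c (rightAct B c x p b ⊗ₜ[ℤ] freeHModuleGen c) := by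
  let φ : (freeHModule.{w, u} c).obj x →+ (tensorFunctor B).obj (freeHModule.{w, u} c) :=
    (tensorι B (freeHModule.{w, u} c) x).comp (TensorProduct.mk ℤ (B.obj (op x))
      ((freeHModule.{w, u} c).obj x) b).toAddMonoidHom
  let ψ : (freeHModule.{w, u} c).obj x →+ (tensorFunctor B).obj (freeHModule.{w, u} c) :=
    (tensorι B (freeHModule.{w, u} c) c).comp
      ((((TensorProduct.mk ℤ (B.obj (op c)) ((freeHModule.{w, u} c).obj c)).flip
        (freeHModuleGen c)).toAddMonoidHom).comp ((rightAct B c x).flip b))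
  have h : φ = ψ := by
    refine FreeAbelianGroup.lift_ext _ _ fun f => ?_
    change tensorι B (freeHModule.{w, u} c) x (b ⊗ₜ[ℤ] FreeAbelianGroup.of f) =
      tensorι B (freeHModule.{w, u} c) c
        (rightAct B c x (FreeAbelianGroup.of f) b ⊗ₜ[ℤ] freeHModuleGen c)
    rw [rightAct_of, tensorι_condition]
    congr 2
    refine ((freeHModule_map_of f.down (ULift.up (𝟙 c))).trans ?_).symm
    rw [Category.id_comp]
  exact DFunLike.congr_fun h p

/-- The homomorphism `B ⊗ ℤ[Hom(c, -)] → B(c)`, `b ⊗ f ↦ B(f)(b)`. -/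
noncomputable def tensorFreeEval (B : RightHModule.{w, u} M) (c : Factorizations M) :
    (tensorFunctor B).obj (freeHModule.{w, u} c) ⟶ B.obj (op c) :=
  tensorDesc (fun x => TensorProduct.liftAddHom (rightAct B c x).flip fun n b p =>
      (DFunLike.congr_fun (map_zsmul (rightAct B c x).flip n b) p).trans
        (map_zsmul ((rightAct B c x).flip b) n p).symm)
    fun _ _ k b p => rightAct_map B c k b p

theorem tensorFreeEval_tensorι (B : RightHModule.{w, u} M) {c x : Factorizations M}
    (b : B.obj (op x)) (p : (freeHModule.{w, u} c).obj x) :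
    tensorFreeEval B c (tensorι B (freeHModule.{w, u} c) x (b ⊗ₜ[ℤ] p)) =
      rightAct B c x p b :=
  tensorDesc_tensorι _ _ x (b ⊗ₜ[ℤ] p)

/-- The co-Yoneda isomorphism `B ⊗ ℤ[Hom(c, -)] ≅ B(c)`. -/
noncomputable def tensorFreeIso (B : RightHModule.{w, u} M) (c : Factorizations M) :
    (tensorFunctor B).obj (freeHModule.{w, u} c) ≅ B.obj (op c) where
  hom := tensorFreeEval B c
  inv := AddCommGrpCat.ofHom ((tensorι B (freeHModule.{w, u} c) c).comp
    ((TensorProduct.mk ℤ (B.obj (op c)) ((freeHModule.{w, u} c).obj c)).flip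
      (freeHModuleGen c)).toAddMonoidHom)
  hom_inv_id := tensor_hom_ext fun x b p =>
    (congrArg (fun t => tensorι B (freeHModule.{w, u} c) c (t ⊗ₜ[ℤ] freeHModuleGen c))
      (tensorFreeEval_tensorι B b p)).trans (tensorι_freeHModule B b p).symm
  inv_hom_id := by
    ext b
    refine (tensorFreeEval_tensorι B b _).trans ((rightAct_of B _ b).trans ?_)
    rw [op_id, B.map_id]

/-- Under the co-Yoneda isomorphisms, the morphism of free modules given by a formal combination
of arrows `d ⟶ c` becomes the action of that combination on `B`. -/
theorem tensorFreeIso_naturality (B : RightHModule.{w, u} M) {c d : Factorizations M}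
    (g : (freeHModule.{w, u} d).obj c) :
    (tensorFunctor B).map (freeHModuleDesc g) ≫ (tensorFreeIso B d).hom =
      (tensorFreeIso B c).hom ≫ AddCommGrpCat.ofHom (rightAct B d c g) := by
  rw [← Iso.inv_comp_eq]
  ext b
  change tensorFreeEval B d ((tensorFunctor B).map (freeHModuleDesc g)
    (tensorι B (freeHModule.{w, u} c) c (b ⊗ₜ[ℤ] freeHModuleGen c))) = rightAct B d c g b
  rw [tensorFunctor_map_tensorι, tensorFreeEval_tensorι, freeHModuleDesc_gen]

end Free

/-! ### Resolutions by free modules on one generator -/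

section Resolution

/-- Exactness in a category of functors is pointwise. -/
theorem exact_of_exact_evaluation {J : Type*} [Category J]
    (S : ShortComplex (J ⥤ AddCommGrpCat.{u}))
    (h : ∀ j, (S.map ((evaluation J AddCommGrpCat.{u}).obj j)).Exact) : S.Exact := by
  rw [ShortComplex.exact_iff_isZero_homology]
  refine Functor.isZero _ fun j => ?_
  exact ((ShortComplex.exact_iff_isZero_homology _).1 (h j)).of_iso
    (S.mapHomologyIso ((evaluation J AddCommGrpCat.{u}).obj j)).symm

variable {M : Type w} [AddMonoid M]

/-- The augmentation `ℤ[Hom(c, -)] ⟶ ℤ`, which sends each arrow to `1`. -/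
def freeHModuleAug (c : Factorizations M) : freeHModule.{w, u} c ⟶ trivialHModule.{w, u} M :=
  freeHModuleDesc (ULift.up 1 : ULift.{max u w} ℤ)

/-- A sequence of objects `c n` and of formal combinations `rel n` of arrows `c n ⟶ c (n + 1)`
such that the free modules on one generator at `c n`, with the differentials given by the `rel n`,
resolve the trivial module `ℤ`. -/
structure FreeResolution (M : Type w) [AddMonoid M] where
  /-- The object at which the generator of degree `n` lives. -/
  c : ℕ → Factorizations M
  /-- The image of the generator of degree `n + 1` under the differential. -/
  rel : ∀ n, (freeHModule.{w, u} (c n)).obj (c (n + 1))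
  /-- The differential squares to zero. -/
  sq : ∀ n, freeHModuleDesc (rel (n + 1)) ≫ freeHModuleDesc (rel n) = 0
  aug : freeHModuleDesc (rel 0) ≫ freeHModuleAug (c 0) = 0
  aug_surjective : ∀ z, Function.Surjective ((freeHModuleAug.{w, u} (c 0)).app z)
  exact_aug : ∀ z (p : (freeHModule.{w, u} (c 0)).obj z), (freeHModuleAug (c 0)).app z p = 0 →
    ∃ p', (freeHModuleDesc (rel 0)).app z p' = p
  exact_succ : ∀ n z (p : (freeHModule.{w, u} (c (n + 1))).obj z),
    (freeHModuleDesc (rel n)).app z p = 0 → ∃ p', (freeHModuleDesc (rel (n + 1))).app z p' = p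

namespace FreeResolution

variable (R : FreeResolution.{w, u} M)

/-- The chain complex of free modules. -/
noncomputable def complex : ChainComplex (LeftHModule.{w, u} M) ℕ :=
  ChainComplex.of (fun n => freeHModule (R.c n)) (fun n => freeHModuleDesc (R.rel n)) R.sq

theorem complex_d (n : ℕ) : R.complex.d (n + 1) n = freeHModuleDesc (R.rel n) :=
  ChainComplex.of_d (fun n => freeHModule (R.c n)) (fun n => freeHModuleDesc (R.rel n)) n

/-- The augmentation of the chain complex of free modules, as a chain map. -/
noncomputable def π :
    R.complex ⟶ (ChainComplex.single₀ (LeftHModule.{w, u} M)).obj (trivialHModule.{w, u} M) :=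
  (R.complex.toSingle₀Equiv _).symm ⟨freeHModuleAug (R.c 0), by
    rw [complex_d]
    exact R.aug⟩

theorem π_f_zero : R.π.f 0 = freeHModuleAug (R.c 0) :=
  ChainComplex.toSingle₀Equiv_symm_apply_f_zero _ _

theorem quasiIso_π : QuasiIso R.π where
  quasiIsoAt n := by
    cases n with
    | zero =>
      rw [ChainComplex.quasiIsoAt₀_iff, ShortComplex.quasiIso_iff_of_zeros' _
        (R.complex.shape _ _ (by simp)) rfl rfl]
      refine ⟨exact_of_exact_evaluation _ fun z => ?_, ?_⟩
      · rw [ShortComplex.ab_exact_iff]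
        intro p hp
        obtain ⟨p', hp'⟩ := R.exact_aug z p (by
          rw [← π_f_zero]
          exact hp)
        refine ⟨p', Eq.trans ?_ hp'⟩
        rw [← complex_d]
        rfl
      · have h : Epi (freeHModuleAug.{w, u} (R.c 0)) :=
          (NatTrans.epi_iff_epi_app _).2 fun z =>
            (AddCommGrpCat.epi_iff_surjective _).2 (R.aug_surjective z)
        rw [← π_f_zero] at h
        exact h
    | succ n =>
      rw [quasiIsoAt_iff_exactAt' _ _ (ChainComplex.exactAt_succ_single_obj _ _),
        HomologicalComplex.exactAt_iff' _ (n + 2) (n + 1) n (by simp) (by simp)]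
      refine exact_of_exact_evaluation _ fun z => ?_
      rw [ShortComplex.ab_exact_iff]
      intro p hp
      obtain ⟨p', hp'⟩ := R.exact_succ n z p (by
        rw [← complex_d]
        exact hp)
      refine ⟨p', Eq.trans ?_ hp'⟩
      rw [← complex_d]
      rfl

/-- The projective resolution of the trivial module underlying a resolution by free modules. -/
noncomputable def projectiveResolution : ProjectiveResolution (trivialHModule.{w, u} M) where
  complex := R.complex
  projective n := projective_freeHModule (R.c n)
  π := R.π
  quasiIso := R.quasiIso_π

variable (B : RightHModule.{w, u} M)

/-- The differential `B(c (n + 1)) → B(c n)` of the complex `B ⊗ R`. -/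
def differential (n : ℕ) : B.obj (op (R.c (n + 1))) →+ B.obj (op (R.c n)) :=
  rightAct B (R.c n) (R.c (n + 1)) (R.rel n)

/-- The identification of the terms of the complex `B ⊗ R`. -/
noncomputable def tensorXIso (n : ℕ) :
    (tensorFunctor B).obj (R.complex.X n) ≅ AddCommGrpCat.of (B.obj (op (R.c n))) :=
  tensorFreeIso B (R.c n)

theorem tensor_complex_d (n : ℕ) :
    (tensorFunctor B).map (R.complex.d (n + 1) n) ≫ (R.tensorXIso B n).hom =
      (R.tensorXIso B (n + 1)).hom ≫ AddCommGrpCat.ofHom (R.differential B n) := by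
  rw [complex_d]
  exact tensorFreeIso_naturality B (R.rel n)

theorem differential_comp (n : ℕ) :
    (R.differential B n).comp (R.differential B (n + 1)) = 0 := by
  have h : AddCommGrpCat.ofHom (R.differential B (n + 1)) ≫
      AddCommGrpCat.ofHom (R.differential B n) = 0 := by
    rw [← cancel_epi (R.tensorXIso B (n + 2)).hom]
    rw [← Category.assoc, ← R.tensor_complex_d B (n + 1), Category.assoc,
      ← R.tensor_complex_d B n, ← Category.assoc, ← Functor.map_comp, R.complex.d_comp_d,
      Functor.map_zero, zero_comp, comp_zero]
  exact congrArg AddCommGrpCat.Hom.hom h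

/-- The Leech homology of `M` in degree `n + 1` is the homology of the complex `B ⊗ R`. -/
theorem nonempty_leechHomology_succ (n : ℕ) :
    Nonempty (leechHomology B (n + 1) ≃+ (R.differential B n).ker ⧸
      ((R.differential B (n + 1)).range).addSubgroupOf (R.differential B n).ker) := by
  let K := ((tensorFunctor B).mapHomologicalComplex _).obj R.complex
  let S : ShortComplex AddCommGrpCat.{max u w} :=
    ShortComplex.mk (AddCommGrpCat.ofHom (R.differential B (n + 1)))
      (AddCommGrpCat.ofHom (R.differential B n))
      (AddCommGrpCat.hom_ext (R.differential_comp B n))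
  let e : K.sc' (n + 2) (n + 1) n ≅ S :=
    ShortComplex.isoMk (R.tensorXIso B (n + 2)) (R.tensorXIso B (n + 1))
      (R.tensorXIso B n) (R.tensor_complex_d B (n + 1)).symm (R.tensor_complex_d B n).symm
  have i : leechHomology B (n + 1) ≅ S.homology :=
    R.projectiveResolution.isoLeftDerivedObj (tensorFunctor B) (n + 1) ≪≫
      ShortComplex.homologyMapIso (K.isoSc' (n + 2) (n + 1) n (by simp) (by simp) ≪≫ e)
  refine ⟨(i ≪≫ S.abHomologyIso).addCommGroupIsoToAddEquiv.trans
    (QuotientAddGroup.quotientAddEquivOfEq ?_)⟩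
  ext ⟨x, hx⟩
  rw [AddSubgroup.mem_addSubgroupOf]
  exact ⟨fun ⟨y, hy⟩ => ⟨y, congrArg Subtype.val hy⟩, fun ⟨y, hy⟩ => ⟨y, Subtype.ext hy⟩⟩

/-- The Leech homology of `M` in degree `0` is the cokernel of the first differential of the
complex `B ⊗ R`. -/
theorem nonempty_leechHomology_zero :
    Nonempty (leechHomology B 0 ≃+ B.obj (op (R.c 0)) ⧸ (R.differential B 0).range) := by
  let K := ((tensorFunctor B).mapHomologicalComplex _).obj R.complex
  let S : ShortComplex AddCommGrpCat.{max u w} :=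
    ShortComplex.mk (AddCommGrpCat.ofHom (R.differential B 0))
      (0 : AddCommGrpCat.of (B.obj (op (R.c 0))) ⟶ AddCommGrpCat.of (B.obj (op (R.c 0))))
      comp_zero
  let e : K.sc' 1 0 0 ≅ S :=
    ShortComplex.isoMk (R.tensorXIso B 1) (R.tensorXIso B 0)
      (R.tensorXIso B 0) (R.tensor_complex_d B 0).symm (by
        refine comp_zero.trans (Eq.symm ?_)
        exact (congrArg (· ≫ (R.tensorXIso B 0).hom) (K.shape 0 0 (by simp))).trans zero_comp)
  have i : leechHomology B 0 ≅ S.homology :=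
    R.projectiveResolution.isoLeftDerivedObj (tensorFunctor B) 0 ≪≫
      ShortComplex.homologyMapIso (K.isoSc' 1 0 0 (by simp) (by simp) ≪≫ e)
  have j : S.homology ≅ AddCommGrpCat.of (B.obj (op (R.c 0)) ⧸ (R.differential B 0).range) :=
    (ShortComplex.LeftHomologyData.ofIsColimitCokernelCofork S rfl _
      (AddCommGrpCat.cokernelIsColimit S.f)).homologyIso
  exact ⟨(i ≪≫ j).addCommGroupIsoToAddEquiv⟩

end FreeResolution

end Resolution

/-! ### The periodic resolution of a cyclic monoid -/

namespace CyclicMonoid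

variable {m q : ℕ} [NeZero q]

theorem proj_zero : proj m q 0 = 0 := rfl

theorem proj_add_add (a b : ℕ) (x : CyclicMonoid m q) :
    proj m q a + x + proj m q b = x + proj m q (a + b) := by
  rw [proj_add, add_comm (proj m q a), add_assoc]

/-- The value at `z` of the free module on one generator at `x`. -/
abbrev FreeVal (x z : CyclicMonoid m q) : Type u :=
  (freeHModule.{0, u} (Factorizations.mk x)).obj (Factorizations.mk z)

open Classical in
/-- The arrow `(a, x, b) : x ⟶ z`, for natural numbers `a` and `b`, as a generator of the value
at `z` of the free module on one generator at `x`; it is `0` if there is no such arrow, that is,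
if `x ⊕ a ⊕ b` is not `z`. With this convention the identities below hold for all `z`. It is written
as the monomial `X ^ a Y ^ b` of the monoid ring of `C × C`; only the classes of `a` and `b` in `C`
matter. -/
noncomputable def gen (x z : CyclicMonoid m q) (a b : ℕ) : FreeVal.{u} x z :=
  if h : x + proj m q (a + b) = z then
    FreeAbelianGroup.of (ULift.up (Factorizations.arrow (proj m q a) (proj m q b)
      ((proj_add_add a b x).trans h)))
  else 0

theorem gen_of_eq {x z : CyclicMonoid m q} {a b : ℕ} (h : x + proj m q (a + b) = z) :
    gen.{u} x z a b = FreeAbelianGroup.of (ULift.up (Factorizations.arrow (proj m q a)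
      (proj m q b) ((proj_add_add a b x).trans h))) :=
  dif_pos h

theorem gen_of_ne {x z : CyclicMonoid m q} {a b : ℕ} (h : x + proj m q (a + b) ≠ z) :
    gen.{u} x z a b = 0 :=
  dif_neg h

theorem gen_congr (x z : CyclicMonoid m q) {a a' b b' : ℕ} (ha : proj m q a = proj m q a')
    (hb : proj m q b = proj m q b') : gen.{u} x z a b = gen x z a' b' := by
  have hab : proj m q (a + b) = proj m q (a' + b') := by rw [proj_add, proj_add, ha, hb]
  by_cases h : x + proj m q (a + b) = z
  · rw [gen_of_eq h, gen_of_eq (hab ▸ h)]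
    congr 2
    exact Factorizations.Hom.ext ha hb
  · rw [gen_of_ne h, gen_of_ne (hab ▸ h)]

theorem of_eq_gen {x z : CyclicMonoid m q}
    (f : ULift.{u} (Factorizations.mk x ⟶ Factorizations.mk z)) :
    (FreeAbelianGroup.of f : FreeVal.{u} x z) =
      gen x z (Factorizations.Hom.left f.down).val (Factorizations.Hom.right f.down).val := by
  have h := Factorizations.Hom.eq f.down
  rw [gen_of_eq]
  · congr 1
    ext1
    exact Factorizations.Hom.ext (proj_val _).symm (proj_val _).symm
  · rw [← proj_add_add, proj_val, proj_val]
    exact h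

/-- The monomials `X ^ a Y ^ b` with `b < m + q` generate. -/
theorem gen_hom_ext {x z : CyclicMonoid m q} {A : Type*} [AddCommGroup A]
    {φ ψ : FreeVal.{u} x z →+ A}
    (h : ∀ a b, b < m + q → φ (gen x z a b) = ψ (gen x z a b)) : φ = ψ := by
  refine FreeAbelianGroup.lift_ext _ _ fun f => ?_
  have := h (Factorizations.Hom.left f.down).val _ (Factorizations.Hom.right f.down).lt
  rw [← of_eq_gen] at this
  exact this

/-- Composition of arrows. -/
theorem leftAct_gen {x y : CyclicMonoid m q} (z : CyclicMonoid m q) {s t : ℕ}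
    (h : x + proj m q (s + t) = y) (a b : ℕ) :
    leftAct (freeHModule.{0, u} (Factorizations.mk x)) (Factorizations.mk y) (Factorizations.mk z)
      (gen y z a b) (gen x y s t) = gen x z (a + s) (t + b) := by
  have hd : y + proj m q (a + b) = x + proj m q (a + s + (t + b)) := by
    rw [← h, add_assoc, ← proj_add]
    congr 2
    omega
  by_cases hz : y + proj m q (a + b) = z
  · rw [gen_of_eq hz, gen_of_eq h, gen_of_eq (hd ▸ hz)]
    refine (leftAct_of _ _ _).trans ((freeHModule_map_of _ _).trans ?_)
    congr 2
    exact Factorizations.Hom.ext (proj_add _ _).symm (proj_add _ _).symm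
  · rw [gen_of_ne hz, gen_of_ne (x := x) (z := z) (a := a + s) (by rwa [← hd])]
    exact DFunLike.congr_fun (map_zero (leftAct (freeHModule.{0, u} (Factorizations.mk x))
      (Factorizations.mk y) (Factorizations.mk z))) _

/-- The combination `(0, x, 1) - (1, x, 0)` of arrows `x ⟶ y`, where `y = x ⊕ 1`. In the monoid
ring of `C × C` it is multiplication by `Y - X`. -/
noncomputable def relS (x y : CyclicMonoid m q) : FreeVal.{u} x y :=
  gen x y 0 1 - gen x y 1 0

/-- The combination of arrows `x ⟶ y` which defines the trace map, where `x = p ⊕ 1` and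
`y = p ⊕ m`. In the monoid ring of `C × C` it is multiplication by `(f(Y) - f(X)) / (Y - X)` for
`f = X ^ (m + q) - X ^ m`. -/
noncomputable def relT (x y : CyclicMonoid m q) : FreeVal.{u} x y :=
  ∑ t ∈ Finset.range (m + q), gen x y t (m + q - 1 - t) -
    ∑ t ∈ Finset.range m, gen x y t (m - 1 - t)

/-- The differential `X ^ a Y ^ b ↦ X ^ a Y ^ (b + 1) - X ^ (a + 1) Y ^ b` from odd to even
degrees, at the object `z`. -/
noncomputable def diffS (x y z : CyclicMonoid m q) : FreeVal.{u} y z →+ FreeVal.{u} x z :=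
  ((freeHModuleDesc (relS x y)).app (Factorizations.mk z)).hom

/-- The differential from even to odd degrees, at the object `z`. -/
noncomputable def diffT (x y z : CyclicMonoid m q) : FreeVal.{u} y z →+ FreeVal.{u} x z :=
  ((freeHModuleDesc (relT x y)).app (Factorizations.mk z)).hom

theorem diffS_gen {x y : CyclicMonoid m q} (z : CyclicMonoid m q) (h : y = x + proj m q 1)
    (a b : ℕ) :
    diffS.{u} x y z (gen y z a b) = gen x z a (b + 1) - gen x z (a + 1) b := by
  have h' : diffS.{u} x y z (gen y z a b) = leftAct _ _ (Factorizations.mk z) (gen y z a b)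
      (gen.{u} x y 0 1) - leftAct _ _ (Factorizations.mk z) (gen y z a b) (gen.{u} x y 1 0) :=
    map_sub (leftAct _ _ (Factorizations.mk z) (gen y z a b)) _ _
  rw [h', leftAct_gen z h.symm, leftAct_gen z h.symm, add_comm 1 b, zero_add, add_zero]

theorem diffT_gen {p x y : CyclicMonoid m q} (z : CyclicMonoid m q) (hx : x = p + proj m q 1)
    (hy : y = p + proj m q m) (a b : ℕ) :
    diffT.{u} x y z (gen y z a b) =
      ∑ t ∈ Finset.range (m + q), gen x z (a + t) (m + q - 1 - t + b) -
        ∑ t ∈ Finset.range m, gen x z (a + t) (m - 1 - t + b) := by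
  change leftAct _ _ (Factorizations.mk z) (gen y z a b) (relT x y) = _
  rw [relT, map_sub, map_sum, map_sum]
  congr 1
  · refine Finset.sum_congr rfl fun t ht => leftAct_gen z ?_ a b
    have := Finset.mem_range.1 ht
    rw [hx, hy, add_assoc, ← proj_add, show 1 + (t + (m + q - 1 - t)) = m + q by omega,
      proj_add_period le_rfl]
  · refine Finset.sum_congr rfl fun t ht => leftAct_gen z ?_ a b
    have := Finset.mem_range.1 ht
    rw [hx, hy, add_assoc, ← proj_add, show 1 + (t + (m - 1 - t)) = m by omega]

/-- `(Y - X) ∑_{t < n} X ^ t Y ^ (n - 1 - t) = Y ^ n - X ^ n`. -/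
theorem sum_gen_sub_sum_gen (x z : CyclicMonoid m q) (a b n : ℕ) :
    ∑ t ∈ Finset.range n, gen.{u} x z (a + t) (n - 1 - t + b + 1) -
      ∑ t ∈ Finset.range n, gen x z (a + t + 1) (n - 1 - t + b) =
      gen x z a (n + b) - gen x z (a + n) b := by
  rw [← Finset.sum_sub_distrib]
  have h := Finset.sum_range_sub' (fun t => gen.{u} x z (a + t) (n - t + b)) n
  simp only [Nat.sub_self, Nat.sub_zero, add_zero, zero_add] at h
  rw [← h]
  refine Finset.sum_congr rfl fun t ht => ?_
  have := Finset.mem_range.1 ht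
  congr 2 <;> omega

/-- `f(Y) - f(X) = 0` for `f = X ^ (m + q) - X ^ m`. -/
theorem gen_period (x z : CyclicMonoid m q) (a b : ℕ) :
    gen.{u} x z a (m + q + b) - gen x z (a + (m + q)) b =
      gen x z a (m + b) - gen x z (a + m) b := by
  rw [gen_congr x z (rfl : proj m q a = _) (show proj m q (m + q + b) = proj m q (m + b) by
      rw [show m + q + b = m + b + q by omega, proj_add_period (by omega)]),
    gen_congr x z (show proj m q (a + (m + q)) = proj m q (a + m) by
      rw [← add_assoc, proj_add_period (by omega)]) (rfl : proj m q b = _)]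

/-- The trace relation does not distinguish the left variable from the right one: multiplication by
`Y - X` followed by multiplication by `(f(Y) - f(X)) / (Y - X)` is zero. -/
theorem diffT_gen_succ {p x y : CyclicMonoid m q} (z : CyclicMonoid m q)
    (hx : x = p + proj m q 1) (hy : y = p + proj m q m) (a b : ℕ) :
    diffT.{u} x y z (gen y z a (b + 1)) = diffT.{u} x y z (gen y z (a + 1) b) := by
  rw [diffT_gen z hx hy, diffT_gen z hx hy, ← sub_eq_zero]
  have h1 := sum_gen_sub_sum_gen.{u} x z a b (m + q)
  have h2 := sum_gen_sub_sum_gen.{u} x z a b m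
  rw [gen_period] at h1
  rw [← h2, ← sub_eq_zero] at h1
  rw [← h1]
  simp only [add_right_comm a 1, add_assoc]
  abel

theorem diffT_gen_eq {p x y : CyclicMonoid m q} (z : CyclicMonoid m q)
    (hx : x = p + proj m q 1) (hy : y = p + proj m q m) (a b : ℕ) :
    diffT.{u} x y z (gen y z a b) = diffT.{u} x y z (gen y z (a + b) 0) := by
  induction b generalizing a with
  | zero => rfl
  | succ b ih => rw [diffT_gen_succ z hx hy, ih, add_assoc, add_comm 1 b]

theorem diffT_diffS_gen {p x y y' : CyclicMonoid m q} (z : CyclicMonoid m q)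
    (hx : x = p + proj m q 1) (hy : y = p + proj m q m) (hy' : y' = y + proj m q 1) (a b : ℕ) :
    diffT.{u} x y z (diffS.{u} y y' z (gen y' z a b)) = 0 := by
  rw [diffS_gen z hy', map_sub, diffT_gen_succ z hx hy, sub_self]

theorem diffS_diffT_gen {p x y : CyclicMonoid m q} (z : CyclicMonoid m q)
    (hx : x = p + proj m q 1) (hy : y = p + proj m q m) (a b : ℕ) :
    diffS.{u} p x z (diffT.{u} x y z (gen y z a b)) = 0 := by
  rw [diffT_gen z hx hy, map_sub, map_sum, map_sum]
  simp only [diffS_gen z hx, Finset.sum_sub_distrib]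
  rw [sum_gen_sub_sum_gen, sum_gen_sub_sum_gen, gen_period, sub_self]

/-! ### The contracting homotopy -/

/-- The contracting homotopy from even to odd degrees:
`X ^ a Y ^ b ↦ ∑_{i < b} X ^ (a + i) Y ^ (b - 1 - i)` for `b < m + q`. -/
noncomputable def homotopyS (x y z : CyclicMonoid m q) : FreeVal.{u} x z →+ FreeVal.{u} y z :=
  FreeAbelianGroup.lift fun f => ∑ i ∈ Finset.range (Factorizations.Hom.right f.down).val,
    gen y z ((Factorizations.Hom.left f.down).val + i)
      ((Factorizations.Hom.right f.down).val - 1 - i)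

/-- The contracting homotopy from odd to even degrees: it sends `X ^ a Y ^ (m + q - 1)` to `X ^ a`
and `X ^ a Y ^ b` to `0` for `b < m + q - 1`. -/
noncomputable def homotopyT (x y z : CyclicMonoid m q) : FreeVal.{u} x z →+ FreeVal.{u} y z :=
  FreeAbelianGroup.lift fun f => if (Factorizations.Hom.right f.down).val = m + q - 1 then
    gen y z (Factorizations.Hom.left f.down).val 0 else 0

theorem proj_rep (a : ℕ) : proj m q (proj m q a).val = proj m q a := proj_val _

theorem proj_val_of_lt {b : ℕ} (hb : b < m + q) : (proj m q b).val = b := rep_of_lt hb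

theorem homotopyS_gen {x y : CyclicMonoid m q} (z : CyclicMonoid m q) (hy : y = x + proj m q 1)
    {a b : ℕ} (hb : b < m + q) :
    homotopyS.{u} x y z (gen x z a b) = ∑ i ∈ Finset.range b, gen y z (a + i) (b - 1 - i) := by
  by_cases h : x + proj m q (a + b) = z
  · rw [gen_of_eq h]
    refine (FreeAbelianGroup.lift_apply_of _ _).trans ?_
    change ∑ i ∈ Finset.range (proj m q b).val,
      gen y z ((proj m q a).val + i) ((proj m q b).val - 1 - i) = _
    rw [proj_val_of_lt hb]
    refine Finset.sum_congr rfl fun i _ => gen_congr y z ?_ rfl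
    rw [proj_add, proj_rep, proj_add]
  · rw [gen_of_ne h, map_zero]
    refine (Finset.sum_eq_zero fun i hi => gen_of_ne ?_).symm
    have := Finset.mem_range.1 hi
    rwa [hy, add_assoc, ← proj_add, show 1 + (a + i + (b - 1 - i)) = a + b by omega]

theorem homotopyT_gen {p x y : CyclicMonoid m q} (z : CyclicMonoid m q)
    (hx : x = p + proj m q 1) (hy : y = p + proj m q m) {a b : ℕ} (hb : b < m + q) :
    homotopyT.{u} x y z (gen x z a b) = if b = m + q - 1 then gen y z a 0 else 0 := by
  by_cases h : x + proj m q (a + b) = z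
  · rw [gen_of_eq h]
    refine (FreeAbelianGroup.lift_apply_of _ _).trans ?_
    change (if (proj m q b).val = m + q - 1 then gen y z (proj m q a).val 0 else 0) = _
    rw [proj_val_of_lt hb, gen_congr y z (proj_rep a) rfl]
  · rw [gen_of_ne h, map_zero]
    split_ifs with hb'
    · rw [gen_of_ne]
      rwa [hy, add_assoc, ← proj_add, ← proj_add_period (by omega),
        show m + (a + 0) + q = 1 + (a + b) by omega, proj_add, ← add_assoc, ← hx]
    · rfl

theorem diffS_homotopyS_gen {x y : CyclicMonoid m q} (z : CyclicMonoid m q)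
    (hy : y = x + proj m q 1) {a b : ℕ} (hb : b < m + q) :
    diffS.{u} x y z (homotopyS x y z (gen x z a b)) = gen x z a b - gen x z (a + b) 0 := by
  rw [homotopyS_gen z hy hb, map_sum]
  simp only [diffS_gen z hy, Finset.sum_sub_distrib]
  exact sum_gen_sub_sum_gen x z a 0 b

theorem homotopyS_diffS_add {p x y : CyclicMonoid m q} (z : CyclicMonoid m q)
    (hx : x = p + proj m q 1) (hy : y = p + proj m q m)
    (c : FreeVal.{u} x z) :
    homotopyS p x z (diffS.{u} p x z c) +
      diffT.{u} x y z (homotopyT x y z c) = c := by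
  have key : (homotopyS p x z).comp (diffS.{u} p x z) + (diffT.{u} x y z).comp (homotopyT x y z) =
      AddMonoidHom.id (FreeVal.{u} x z) := by
    refine gen_hom_ext fun a b hb => ?_
    change homotopyS p x z (diffS.{u} p x z (gen x z a b)) +
      diffT.{u} x y z (homotopyT x y z (gen x z a b)) = gen x z a b
    rw [diffS_gen z hx, map_sub, homotopyT_gen z hx hy hb, homotopyS_gen z hx hb]
    have hsum : ∑ i ∈ Finset.range (b + 1), gen.{u} x z (a + i) (b - i) =
        ∑ i ∈ Finset.range b, gen x z (a + 1 + i) (b - 1 - i) + gen x z a b := by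
      rw [Finset.sum_range_succ']
      congr 1
      refine Finset.sum_congr rfl fun i _ => ?_
      congr 1 <;> omega
    split_ifs with hb'
    -- If `b = m + q - 1`, then `Y ^ (b + 1) = Y ^ m` shortens the first sum of the homotopy, and
    -- the trace term makes up for the difference.
    · have hm : gen.{u} p z a (b + 1) = gen p z a m :=
        gen_congr p z rfl (by rw [show b + 1 = m + q by omega, proj_add_period le_rfl])
      have hq := Nat.pos_of_neZero q
      rw [hm, homotopyS_gen z hx (by omega), diffT_gen z hx hy]
      rw [show b + 1 = m + q by omega] at hsum
      simp only [add_zero, ← hb']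
      rw [hsum]
      abel
    · rw [homotopyS_gen z hx (by omega), Nat.add_sub_cancel, hsum, map_zero]
      change _ - _ + 0 = _
      abel
  exact DFunLike.congr_fun key c

theorem homotopyT_diffT_add {p x y y' : CyclicMonoid m q} (z : CyclicMonoid m q)
    (hx : x = p + proj m q 1) (hy : y = p + proj m q m) (hy' : y' = y + proj m q 1)
    (c : FreeVal.{u} y z) :
    homotopyT x y z (diffT.{u} x y z c) +
      diffS.{u} y y' z (homotopyS y y' z c) = c := by
  have key : (homotopyT x y z).comp (diffT.{u} x y z) + (diffS.{u} y y' z).comp (homotopyS y y' z) =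
      AddMonoidHom.id (FreeVal.{u} y z) := by
    refine gen_hom_ext fun a b hb => ?_
    change homotopyT x y z (diffT.{u} x y z (gen y z a b)) +
      diffS.{u} y y' z (homotopyS y y' z (gen y z a b)) = gen y z a b
    rw [diffS_homotopyS_gen z hy' hb, diffT_gen_eq z hx hy, diffT_gen z hx hy]
    have hq := Nat.pos_of_neZero q
    -- Only the summand `X ^ (a + b) Y ^ (m + q - 1)` of the trace survives the homotopy.
    have h1 : ∑ t ∈ Finset.range (m + q),
        homotopyT.{u} x y z (gen x z (a + b + t) (m + q - 1 - t + 0)) = gen y z (a + b) 0 := by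
      rw [Finset.sum_eq_single 0]
      · rw [homotopyT_gen z hx hy (by omega), if_pos (by omega)]
        rfl
      · intro t ht h0
        have := Finset.mem_range.1 ht
        rw [homotopyT_gen z hx hy (by omega), if_neg (by omega)]
      · intro h
        exact absurd (Finset.mem_range.2 (by omega)) h
    have h2 : ∑ t ∈ Finset.range m,
        homotopyT.{u} x y z (gen x z (a + b + t) (m - 1 - t + 0)) = 0 := by
      refine Finset.sum_eq_zero fun t ht => ?_
      have := Finset.mem_range.1 ht
      rw [homotopyT_gen z hx hy (by omega), if_neg (by omega)]
    rw [map_sub, map_sum, map_sum, h1, h2]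
    abel
  exact DFunLike.congr_fun key c

end CyclicMonoid

namespace CyclicMonoid

variable {m q : ℕ} [NeZero q]

/-! ### The resolution and the homology of a cyclic monoid -/

/-- The object `r · m` or `r · m ⊕ 1` which carries the generator of the resolution in degree
`2 r` or `2 r + 1`. -/
def degree (m q : ℕ) [NeZero q] (n : ℕ) : CyclicMonoid m q := proj m q (n / 2 * m + n % 2)

theorem degree_even (r : ℕ) : degree m q (2 * r) = r • proj m q m := by
  rw [nsmul_proj, degree, Nat.mul_div_cancel_left r two_pos, Nat.mul_mod_right, add_zero]

theorem degree_zero : degree m q 0 = 0 :=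
  (degree_even 0).trans (zero_nsmul _)

theorem degree_succ_of_even {n : ℕ} (hn : n % 2 = 0) :
    degree m q (n + 1) = degree m q n + proj m q 1 := by
  rw [degree, degree, ← proj_add, show (n + 1) / 2 = n / 2 by omega, hn,
    show (n + 1) % 2 = 1 by omega, add_zero]

theorem degree_add_two (n : ℕ) : degree m q (n + 2) = degree m q n + proj m q m := by
  rw [degree, degree, ← proj_add, show (n + 2) / 2 = n / 2 + 1 by omega, Nat.add_mod_right,
    Nat.succ_mul, add_right_comm]

theorem exists_degree_of_odd {n : ℕ} (hn : n % 2 = 1) :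
    ∃ p, degree m q n = p + proj m q 1 ∧ degree m q (n + 1) = p + proj m q m := by
  obtain ⟨k, rfl⟩ : ∃ k, n = k + 1 := ⟨n - 1, by omega⟩
  exact ⟨degree m q k, degree_succ_of_even (by omega), degree_add_two k⟩

/-- The image of the generator in degree `n + 1` under the differential of the resolution. -/
noncomputable def rel (m q : ℕ) [NeZero q] (n : ℕ) :
    FreeVal.{u} (degree m q n) (degree m q (n + 1)) :=
  if n % 2 = 0 then relS _ _ else relT _ _

theorem rel_of_even {n : ℕ} (hn : n % 2 = 0) :
    rel.{u} m q n = relS (degree m q n) (degree m q (n + 1)) :=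
  if_pos hn

theorem rel_of_odd {n : ℕ} (hn : n % 2 = 1) :
    rel.{u} m q n = relT (degree m q n) (degree m q (n + 1)) :=
  if_neg (by omega)

theorem freeHModuleGen_eq_gen (x : CyclicMonoid m q) :
    freeHModuleGen.{0, u} (Factorizations.mk x) = gen x x 0 0 := by
  rw [gen_of_eq (by rw [add_zero, proj_zero, add_zero])]
  rfl

theorem aug_gen {z : CyclicMonoid m q} {x : CyclicMonoid m q} {a b : ℕ}
    (h : x + proj m q (a + b) = z) :
    (freeHModuleAug.{0, u} (Factorizations.mk x)).app (Factorizations.mk z) (gen x z a b) =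
      (ULift.up 1 : ULift.{u} ℤ) := by
  rw [gen_of_eq h]
  exact leftAct_of _ _ _

/-- In degree `0` the contracting homotopy ends with the section `1 ↦ (z, 0)` of the
augmentation. -/
theorem diffS_homotopyS_of_aug_eq_zero {x y : CyclicMonoid m q} (z : CyclicMonoid m q)
    (hx : x = 0) (hy : y = x + proj m q 1) (c : FreeVal.{u} x z)
    (hc : (freeHModuleAug.{0, u} (Factorizations.mk x)).app (Factorizations.mk z) c =
      (0 : ULift.{u} ℤ)) :
    diffS.{u} x y z (homotopyS x y z c) = c := by
  let ε : FreeVal.{u} x z →+ ℤ := AddMonoidHom.comp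
    (AddEquiv.ulift : ULift.{u} ℤ ≃+ ℤ).toAddMonoidHom
    ((freeHModuleAug.{0, u} (Factorizations.mk x)).app (Factorizations.mk z)).hom
  have key : (diffS.{u} x y z).comp (homotopyS x y z) +
      (zmultiplesHom _ (gen.{u} x z z.val 0)).comp ε = AddMonoidHom.id (FreeVal.{u} x z) := by
    refine gen_hom_ext fun a b hb => ?_
    change diffS.{u} x y z (homotopyS x y z (gen x z a b)) + ε (gen x z a b) • gen x z z.val 0 =
      gen x z a b
    rw [diffS_homotopyS_gen z hy hb]
    by_cases h : x + proj m q (a + b) = z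
    · have h1 : ε (gen x z a b) = 1 := congrArg (ULift.down : ULift.{u} ℤ → ℤ) (aug_gen h)
      rw [h1, one_zsmul, gen_congr x z (a' := z.val) (b' := 0) (a := a + b) _ rfl]
      · abel
      · rw [proj_val, ← h, hx, zero_add]
    · have h' : x + proj m q (a + b + 0) ≠ z := h
      rw [gen_of_ne h, gen_of_ne h', map_zero, zero_smul]
      abel
  have h0 : ε c = 0 := congrArg (ULift.down : ULift.{u} ℤ → ℤ) hc
  have := DFunLike.congr_fun key c
  change diffS.{u} x y z (homotopyS x y z c) + ε c • gen x z z.val 0 = c at this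
  rwa [h0, zero_smul, add_zero] at this

theorem freeHModuleDesc_relT_comp_relS {p x y : CyclicMonoid m q} (hx : x = p + proj m q 1)
    (hy : y = p + proj m q m) :
    freeHModuleDesc (relT.{u} x y) ≫ freeHModuleDesc (relS.{u} p x) = 0 := by
  refine freeHModule_hom_ext ?_
  rw [freeHModuleGen_eq_gen]
  exact diffS_diffT_gen y hx hy 0 0

theorem freeHModuleDesc_relS_comp_relT {p x y y' : CyclicMonoid m q} (hx : x = p + proj m q 1)
    (hy : y = p + proj m q m) (hy' : y' = y + proj m q 1) :
    freeHModuleDesc (relS.{u} y y') ≫ freeHModuleDesc (relT.{u} x y) = 0 := by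
  refine freeHModule_hom_ext ?_
  rw [freeHModuleGen_eq_gen]
  exact diffT_diffS_gen y' hx hy hy' 0 0

theorem freeHModuleDesc_relS_comp_aug {x y : CyclicMonoid m q} (hy : y = x + proj m q 1) :
    freeHModuleDesc (relS.{u} x y) ≫ freeHModuleAug (Factorizations.mk x) = 0 := by
  refine freeHModule_hom_ext ?_
  refine (congrArg ((freeHModuleAug.{0, u} (Factorizations.mk x)).app (Factorizations.mk y))
    (freeHModuleDesc_gen (relS.{u} x y))).trans ?_
  refine (map_sub ((freeHModuleAug.{0, u} (Factorizations.mk x)).app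
    (Factorizations.mk y)).hom _ _).trans ?_
  exact (congrArg₂ (fun a b : ULift.{u} ℤ => a - b) (aug_gen hy.symm) (aug_gen hy.symm)).trans
    (sub_self _)

theorem aug_surjective (z : CyclicMonoid m q) : Function.Surjective
    ((freeHModuleAug.{0, u} (Factorizations.mk (0 : CyclicMonoid m q))).app
      (Factorizations.mk z)) := by
  intro k
  refine ⟨ULift.down.{u} k • gen.{u} 0 z z.val 0, ?_⟩
  refine (map_zsmul ((freeHModuleAug.{0, u} (Factorizations.mk (0 : CyclicMonoid m q))).app
    (Factorizations.mk z)).hom _ _).trans ?_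
  refine (congrArg (fun a : ULift.{u} ℤ => ULift.down.{u} k • a)
    (aug_gen (by rw [zero_add, add_zero, proj_val]))).trans ?_
  exact ULift.down_injective (mul_one (ULift.down.{u} (α := ℤ) k))

theorem exists_diffT_eq {p x y : CyclicMonoid m q} (z : CyclicMonoid m q)
    (hx : x = p + proj m q 1) (hy : y = p + proj m q m) (c : FreeVal.{u} x z)
    (hc : diffS.{u} p x z c = 0) : ∃ c', diffT.{u} x y z c' = c := by
  have h := homotopyS_diffS_add z hx hy c
  rw [hc, map_zero, zero_add] at h
  exact ⟨_, h⟩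

theorem exists_diffS_eq {p x y y' : CyclicMonoid m q} (z : CyclicMonoid m q)
    (hx : x = p + proj m q 1) (hy : y = p + proj m q m) (hy' : y' = y + proj m q 1)
    (c : FreeVal.{u} y z) (hc : diffT.{u} x y z c = 0) : ∃ c', diffS.{u} y y' z c' = c := by
  have h := homotopyT_diffT_add z hx hy hy' c
  rw [hc, map_zero, zero_add] at h
  exact ⟨_, h⟩

/-- The periodic resolution of the trivial module over a cyclic monoid. -/
noncomputable def resolution (m q : ℕ) [NeZero q] :
    FreeResolution.{0, u} (CyclicMonoid m q) where
  c n := Factorizations.mk (degree m q n)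
  rel n := rel m q n
  sq n := by
    rcases Nat.mod_two_eq_zero_or_one n with hn | hn
    · rw [rel_of_even hn, rel_of_odd (by omega)]
      exact freeHModuleDesc_relT_comp_relS (degree_succ_of_even hn) (degree_add_two n)
    · obtain ⟨p, hx, hy⟩ := exists_degree_of_odd (m := m) (q := q) hn
      rw [rel_of_odd hn, rel_of_even (by omega)]
      exact freeHModuleDesc_relS_comp_relT hx hy (degree_succ_of_even (by omega))
  aug := by
    rw [rel_of_even rfl]
    exact freeHModuleDesc_relS_comp_aug (degree_succ_of_even rfl)
  aug_surjective z := by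
    rw [degree_zero]
    exact aug_surjective z.val
  exact_aug z p hp := by
    rw [rel_of_even rfl]
    exact ⟨homotopyS _ _ z.val p,
      diffS_homotopyS_of_aug_eq_zero z.val degree_zero (degree_succ_of_even rfl) p hp⟩
  exact_succ n z c hc := by
    rcases Nat.mod_two_eq_zero_or_one n with hn | hn
    · rw [rel_of_even hn] at hc
      rw [rel_of_odd (by omega)]
      exact exists_diffT_eq z.val (degree_succ_of_even hn) (degree_add_two n) c hc
    · obtain ⟨p, hx, hy⟩ := exists_degree_of_odd (m := m) (q := q) hn
      rw [rel_of_odd hn] at hc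
      rw [rel_of_even (by omega)]
      exact exists_diffS_eq z.val hx hy (degree_succ_of_even (by omega)) c hc

variable (B : RightHModule.{0, u} (CyclicMonoid m q))

/-- The action of a formal combination of arrows `x ⟶ y` on a right module. -/
noncomputable def actBy {x y : CyclicMonoid m q} (p : FreeVal.{u} x y) : B.at y →+ B.at x :=
  rightAct B (Factorizations.mk x) (Factorizations.mk y) p

theorem actBy_gen {x y : CyclicMonoid m q} {a b : ℕ} (h : x + proj m q (a + b) = y) :
    actBy B (gen x y a b) = B.act (proj m q a) (proj m q b) ((proj_add_add a b x).trans h) := by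
  rw [gen_of_eq h]
  exact FreeAbelianGroup.lift_apply_of _ _

theorem actBy_sub {x y : CyclicMonoid m q} (p p' : FreeVal.{u} x y) :
    actBy B (p - p') = actBy B p - actBy B p' :=
  map_sub (rightAct B _ _) _ _

theorem actBy_sum {x y : CyclicMonoid m q} (s : Finset ℕ) (p : ℕ → FreeVal.{u} x y) :
    actBy B (∑ t ∈ s, p t) = ∑ t ∈ s, actBy B (p t) :=
  map_sum (rightAct B _ _) _ _

theorem actBy_relS (x : CyclicMonoid m q) : actBy B (relS x (x + proj m q 1)) = mapS B x := by
  rw [relS, actBy_sub, actBy_gen B (a := 0) (b := 1) rfl, actBy_gen B (a := 1) (b := 0) rfl]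
  rfl

theorem actBy_relT (x y : CyclicMonoid m q) (hx : 1 ≤ x.val) (hy : y = proj m q m + pred x) :
    actBy B (relT x y) = mapT B x y hx hy := by
  rw [relT, actBy_sub, actBy_sum, actBy_sum, mapT, ← Fin.sum_univ_eq_sum_range
    (fun t => actBy B (gen x y t (m + q - 1 - t))), ← Fin.sum_univ_eq_sum_range
    (fun t => actBy B (gen x y t (m - 1 - t)))]
  congr 1
  · refine Finset.sum_congr rfl fun t _ => ?_
    have hd := add_add_of_period hx hy (t := t) (s := m + q - 1 - t) (Or.inl (by omega))
    rw [actBy_gen B ((proj_add_add _ _ _).symm.trans hd)]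
    congr 2
    omega
  · refine Finset.sum_congr rfl fun t _ => ?_
    have hd := add_add_of_period hx hy (t := t) (s := m - 1 - t) (Or.inr (by omega))
    rw [actBy_gen B ((proj_add_add _ _ _).symm.trans hd)]
    congr 2
    omega

/-- Homology in degree `n + 1`, with the objects of the resolution replaced by equal ones. The
relations then live in different types, hence the heterogeneous equalities. -/
theorem homology_succ (n : ℕ) {x y z : CyclicMonoid m q} (hx : degree m q n = x)
    (hy : degree m q (n + 1) = y) (hz : degree m q (n + 2) = z)
    {p : FreeVal.{u} x y} {p' : FreeVal.{u} y z} (hp : HEq (rel.{u} m q n) p)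
    (hp' : HEq (rel.{u} m q (n + 1)) p') :
    (actBy B p').range ≤ (actBy B p).ker ∧ Nonempty (leechHomology B (n + 1) ≃+
      (actBy B p).ker ⧸ ((actBy B p').range).addSubgroupOf (actBy B p).ker) := by
  subst hx hy hz
  obtain rfl := eq_of_heq hp
  obtain rfl := eq_of_heq hp'
  refine ⟨?_, (resolution.{u} m q).nonempty_leechHomology_succ B n⟩
  rintro _ ⟨b, rfl⟩
  exact DFunLike.congr_fun ((resolution.{u} m q).differential_comp B n) b

theorem homology_zero {x y : CyclicMonoid m q} (hx : degree m q 0 = x)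
    (hy : degree m q 1 = y) {p : FreeVal.{u} x y} (hp : HEq (rel.{u} m q 0) p) :
    Nonempty (leechHomology B 0 ≃+ B.at x ⧸ (actBy B p).range) := by
  subst hx hy
  obtain rfl := eq_of_heq hp
  exact (resolution.{u} m q).nonempty_leechHomology_zero B

theorem heq_relS {n : ℕ} {x y : CyclicMonoid m q} (hn : n % 2 = 0) (hx : degree m q n = x)
    (hy : degree m q (n + 1) = y) : HEq (rel.{u} m q n) (relS.{u} x y) := by
  subst hx hy
  exact heq_of_eq (if_pos hn)

theorem heq_relT {n : ℕ} {x y : CyclicMonoid m q} (hn : n % 2 = 1) (hx : degree m q n = x)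
    (hy : degree m q (n + 1) = y) : HEq (rel.{u} m q n) (relT.{u} x y) := by
  subst hx hy
  exact heq_of_eq (if_neg (by omega))

end CyclicMonoid

theorem mainTheorem3 (m q : ℕ) [NeZero q] (hmq : 2 ≤ m + q)
    (B : RightHModule.{0, u} (CyclicMonoid m q)) :
    Nonempty (leechHomology B 0 ≃+ B.at 0 ⧸ (mapS B 0).range) ∧
    ∀ r : ℕ,
      ((mapTAt B hmq r).range ≤ (mapS B (r • CyclicMonoid.proj m q m)).ker ∧
        Nonempty (leechHomology B (2 * r + 1) ≃+
          (mapS B (r • CyclicMonoid.proj m q m)).ker ⧸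
            ((mapTAt B hmq r).range).addSubgroupOf
              (mapS B (r • CyclicMonoid.proj m q m)).ker)) ∧
      ((mapS B ((r + 1) • CyclicMonoid.proj m q m)).range ≤ (mapTAt B hmq r).ker ∧
        Nonempty (leechHomology B (2 * r + 2) ≃+
          (mapTAt B hmq r).ker ⧸
            ((mapS B ((r + 1) • CyclicMonoid.proj m q m)).range).addSubgroupOf
              (mapTAt B hmq r).ker)) := by
  open CyclicMonoid in
  have hS := actBy_relS B
  have hT : ∀ r, actBy B (relT (r • proj m q m + proj m q 1) ((r + 1) • proj m q m)) =
      mapTAt B hmq r := fun r =>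
    actBy_relT B _ _ (one_le_val_nsmul_add_one hmq r) (succ_nsmul_eq hmq r)
  have h0 : ∀ r, degree m q (2 * r) = r • proj m q m := degree_even
  have h1 : ∀ r, degree m q (2 * r + 1) = r • proj m q m + proj m q 1 := fun r => by
    rw [degree_succ_of_even (by omega), degree_even]
  refine ⟨?_, fun r => ⟨?_, ?_⟩⟩
  · have hz : degree m q 1 = 0 + proj m q 1 := by
      rw [← degree_zero]
      exact degree_succ_of_even rfl
    rw [← hS]
    exact homology_zero B degree_zero hz (heq_relS rfl degree_zero hz)
  · rw [← hS, ← hT]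
    exact homology_succ B (2 * r) (h0 r) (h1 r) (h0 (r + 1))
      (heq_relS (by omega) (h0 r) (h1 r)) (heq_relT (by omega) (h1 r) (h0 (r + 1)))
  · rw [← hS, ← hT]
    exact homology_succ B (2 * r + 1) (h1 r) (h0 (r + 1)) (h1 (r + 1))
      (heq_relT (by omega) (h1 r) (h0 (r + 1))) (heq_relS (by omega) (h0 (r + 1)) (h1 (r + 1)))
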